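/- Let $\mathcal E$ be a Euclidean space (a finite-dimensional real inner product space), let $\mathcal M\subset\mathcal E$ be a smoothly embedded manifold without boundary, of dimension $m$, with a smooth Riemannian metric $\langle\cdot,\cdot\rangle_R$ (not necessarily the induced one), and regard each tangent space $T_x\mathcal M$ as a subspace of $\mathcal E$. Let $\mathsf g$ be a metric operator: a smooth map from $\mathcal M$ to the linear operators on $\mathcal E$ such that every $\mathsf g_x$ is self-adjoint and positive definite and $\langle\xi,\eta\rangle_{R,x}=\langle\xi,\mathsf g_x\eta\rangle_{\mathcal E}$ for all $\xi,\eta\in T_x\mathcal M$. For a tangent vector $\xi$, write $D_\xi$ for the directional derivative of vector- or operator-valued functions on $\mathcal M$; for vector fields $X,Y$ on $\mathcal M$ (smooth), $D_XY$ is the derivative along $X$ of $Y$ regarded as an $\mathcal E$-valued function. Let $\nabla$ be the Levi-Civita connection of $\langle\cdot,\cdot\rangle_R$. Then: (1) For every $x\in\mathcal M$, $\langle\omega_1,\omega_2\rangle_{\mathsf g,x}=\langle\omega_1,\mathsf g_x\omega_2\rangle_{\mathcal E}$ is an inner product on $\mathcal E$. If $\Pi_{\mathsf g,x}$ denotes the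 orthogonal projection of $\mathcal E$ onto $T_x\mathcal M$ for this inner product, then $x\mapsto\Pi_{\mathsf g,x}$ is a smooth map from $\mathcal M$ to the linear operators on $\mathcal E$. (2) There is a Christoffel function of $(\mathcal M,\mathsf g,\mathcal E)$, that is, a smooth map $\Gamma$ from $\mathcal M$ to the $\mathcal E$-valued bilinear forms on $\mathcal E$ such that for all vector fields $X,Y$ on $\mathcal M$ and all $x\in\mathcal M$, $$(\nabla_XY)_x=(D_XY)_x+\Gamma(X_x,Y_x)_x .$$ If $\mathcal M\neq\emptyset$ and $m<\dim\mathcal E$, there is more than one Christoffel function. (3) For vector fields $X,Y$, the vector $(\nabla_XY)_x-(D_XY)_x$ depends only on $X_x$ and $Y_x$. On tangent vectors, $\Gamma$ depends only on the restriction of the metric operator to the tangent bundle: if $\mathsf g'$ is a metric operator for a Riemannian metric on $\mathcal M$ with $\langle\xi,\mathsf g_x\eta\rangle_{\mathcal E}=\langle\xi,\mathsf g'_x\eta\rangle_{\mathcal E}$ for all $x\in\mathcal M$ and $\xi,\eta\in T_x\mathcal M$, and $\Gamma,\Gamma'$ are Christoffel functions of $(\mathcal M,\mathsf g,\mathcal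 E)$ and $(\mathcal M,\mathsf g',\mathcal E)$, then $\Gamma(\xi,\eta)_x=\Gamma'(\xi,\eta)_x$ for all $x\in\mathcal M$ and $\xi,\eta\in T_x\mathcal M$. (4) There is a smooth map $\mathcal X$ from $\mathcal M$ to the $\mathcal E$-valued bilinear forms on $\mathcal E$ such that $$\langle\mathcal X(\xi,\eta)_x,\phi\rangle_{\mathcal E}=\langle(D_\phi\mathsf g)_x\xi,\eta\rangle_{\mathcal E}\qquad\text{for all }x\in\mathcal M,\ \xi,\eta,\phi\in T_x\mathcal M,$$ and for every such $\mathcal X$, every Christoffel function $\Gamma$ of $(\mathcal M,\mathsf g,\mathcal E)$, every $x\in\mathcal M$ and all $\xi,\eta\in T_x\mathcal M$, $$\Gamma(\xi,\eta)_x=-(D_\xi\Pi_{\mathsf g})_x\eta+\tfrac12\,\Pi_{\mathsf g,x}\,\mathsf g_x^{-1}\bigl((D_\xi\mathsf g)_x\eta+(D_\eta\mathsf g)_x\xi-\mathcal X(\xi,\eta)_x\bigr).$$ -/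

import Mathlib

open scoped Manifold ContDiff Topology Bundle

noncomputable section

namespace AmbientGeometry

section

variable {m : ℕ} {M : Type*} [TopologicalSpace M] [ChartedSpace (EuclideanSpace ℝ (Fin m)) M]
  [IsManifold (𝓡 m) ∞ M]
  {E : Type*} [NormedAddCommGroup E] [InnerProductSpace ℝ E]

/-- A smooth Riemannian metric on the `m`-dimensional manifold `M`. -/
abbrev RiemMetric (m : ℕ) (M : Type*) [TopologicalSpace M]
    [ChartedSpace (EuclideanSpace ℝ (Fin m)) M] [IsManifold (𝓡 m) ∞ M] :=
  Bundle.ContMDiffRiemannianMetric (𝓡 m) ∞ (EuclideanSpace ℝ (Fin m))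
    (fun x : M => TangentSpace (𝓡 m) x)

/-- A connection on the tangent bundle of `M`. As everywhere in Mathlib, `cov Y x (X x)` is
`(∇_X Y)_x`. -/
abbrev Connection (m : ℕ) (M : Type*) [TopologicalSpace M]
    [ChartedSpace (EuclideanSpace ℝ (Fin m)) M] [IsManifold (𝓡 m) ∞ M] :=
  CovariantDerivative (𝓡 m) (EuclideanSpace ℝ (Fin m)) (fun x : M => TangentSpace (𝓡 m) x)

/-- The connection is torsion-free and compatible with the Riemannian metric `R`. -/
def IsLeviCivita (R : RiemMetric m M) (cov : Connection m M) : Prop :=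
  letI : Bundle.RiemannianBundle (fun x : M => TangentSpace (𝓡 m) x) := ⟨R.toRiemannianMetric⟩
  haveI : IsContMDiffRiemannianBundle (𝓡 m) 1 (EuclideanSpace ℝ (Fin m))
      (fun x : M => TangentSpace (𝓡 m) x) :=
    IsContMDiffRiemannianBundle.of_le (n := ∞) (by norm_cast)
  cov.torsion = 0 ∧
    CovariantDerivative.IsMetricCompatible (I := 𝓡 m) (F := EuclideanSpace ℝ (Fin m))
      (V := fun x : M => TangentSpace (𝓡 m) x) cov

/-- Smooth vector fields on `M`. -/
def IsSmoothField (X : (x : M) → TangentSpace (𝓡 m) x) : Prop :=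
  ContMDiff (𝓡 m) (𝓡 m).tangent ∞
    (fun x => (⟨x, X x⟩ : TangentBundle (𝓡 m) M))

/-- The directional derivative `D_ξ f` at `x` of a vector-valued (or operator-valued) function
on `M` in the direction of the tangent vector `ξ` at `x`. -/
def dirDeriv {F : Type*} [NormedAddCommGroup F] [NormedSpace ℝ F] (f : M → F) {x : M}
    (ξ : TangentSpace (𝓡 m) x) : F :=
  mvfderiv (𝓡 m) f x ξ

/-- For a map `ι : M → E` (below, an embedding), the vector of `E` with which the tangent vector
`ξ` to `M` is identified. -/
def toAmbient (ι : M → E) {x : M} (ξ : TangentSpace (𝓡 m) x) : E :=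
  mvfderiv (𝓡 m) ι x ξ

/-- The tangent space of `M` at `x` as a subspace of `E`. -/
def ambientTangent (m : ℕ) {M : Type*} [TopologicalSpace M]
    [ChartedSpace (EuclideanSpace ℝ (Fin m)) M] (ι : M → E) (x : M) : Submodule ℝ E :=
  LinearMap.range (mvfderiv (𝓡 m) ι x).toLinearMap

/-- `D_X Y` at `x`, for vector fields `X`, `Y` on `M`: the field `Y` is regarded as the `E`-valued
function `y ↦ dι_y (Y y)` and is differentiated in the direction `X x`. -/
def ambientDeriv (ι : M → E) (X Y : (x : M) → TangentSpace (𝓡 m) x) (x : M) : E :=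
  dirDeriv (fun y => toAmbient ι (Y y)) (X x)

/-- A metric operator for the Riemannian manifold `(M, R)`, embedded in `E` by `ι`: a smooth
function with values in the positive-definite (self-adjoint) operators of `E`, which induces `R`
on the tangent spaces. -/
structure MetricOperator (R : RiemMetric m M) (ι : M → E) where
  /-- The operator at a point. -/
  op : M → E →L[ℝ] E
  smooth : ContMDiff (𝓡 m) 𝓘(ℝ, E →L[ℝ] E) ∞ op
  symm (x : M) (v w : E) : inner ℝ (op x v) w = inner ℝ v (op x w)
  pos (x : M) (v : E) (hv : v ≠ 0) : 0 < inner ℝ v (op x v)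
  induces (x : M) (ξ η : TangentSpace (𝓡 m) x) :
    R.inner x ξ η = inner ℝ (toAmbient ι ξ) (op x (toAmbient ι η))

/-- The orthogonal complement of a subspace `V` of `E` for the bilinear form `⟨v, A w⟩`. -/
def opOrthogonal (A : E →L[ℝ] E) (V : Submodule ℝ E) : Submodule ℝ E :=
  (V.map A.toLinearMap)ᗮ

theorem mem_opOrthogonal (A : E →L[ℝ] E) (V : Submodule ℝ E) (v : E) :
    v ∈ opOrthogonal A V ↔ ∀ η ∈ V, inner ℝ v (A η) = 0 := by
  rw [opOrthogonal, Submodule.mem_orthogonal']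
  simp

namespace MetricOperator

variable {R : RiemMetric m M} {ι : M → E}

theorem inner_self_eq_zero (g : MetricOperator R ι) (x : M) {v : E}
    (h : inner ℝ v (g.op x v) = 0) : v = 0 := by
  by_contra hv
  exact (g.pos x v hv).ne' h

theorem injective (g : MetricOperator R ι) (x : M) : Function.Injective (g.op x) := by
  refine (injective_iff_map_eq_zero (g.op x)).2 fun v h => g.inner_self_eq_zero x ?_
  rw [h, inner_zero_right]

variable [FiniteDimensional ℝ E]

theorem isCompl (g : MetricOperator R ι) (x : M) (V : Submodule ℝ E) :
    IsCompl V (opOrthogonal (g.op x) V) := by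
  have hd : Disjoint V (opOrthogonal (g.op x) V) := by
    rw [Submodule.disjoint_def]
    intro v h₁ h₂
    exact g.inner_self_eq_zero x ((mem_opOrthogonal _ _ _).1 h₂ v h₁)
  refine (Submodule.isCompl_iff_disjoint _ _ ?_).2 hd
  have h₁ := Submodule.finrank_add_finrank_orthogonal (V.map (g.op x).toLinearMap)
  have h₂ : Module.finrank ℝ V = Module.finrank ℝ (V.map (g.op x).toLinearMap) :=
    (Submodule.equivMapOfInjective (g.op x).toLinearMap (g.injective x) V).finrank_eq
  rw [opOrthogonal]
  omega

/-- The projection `Π_{g,x}` of `E` onto the tangent space at `x`, orthogonal for the inner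
product `⟨v, g_x w⟩`. -/
def proj (g : MetricOperator R ι) (x : M) : E →L[ℝ] E :=
  LinearMap.toContinuousLinearMap
    ((ambientTangent m ι x).projection (opOrthogonal (g.op x) (ambientTangent m ι x))
      (g.isCompl x (ambientTangent m ι x)))

theorem proj_mem (g : MetricOperator R ι) (x : M) (v : E) :
    g.proj x v ∈ ambientTangent m ι x := by
  simp [proj]

theorem inner_proj (g : MetricOperator R ι) (x : M) (v : E) (η : TangentSpace (𝓡 m) x) :
    inner ℝ (g.proj x v) (g.op x (toAmbient ι η)) =
      inner ℝ v (g.op x (toAmbient ι η)) := by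
  have h := Submodule.projection_add_projection_eq_self (g.isCompl x (ambientTangent m ι x)) v
  have hm : (opOrthogonal (g.op x) (ambientTangent m ι x)).projection (ambientTangent m ι x)
      (g.isCompl x (ambientTangent m ι x)).symm v ∈ opOrthogonal (g.op x) (ambientTangent m ι x) := by
    simp
  have h₀ := (mem_opOrthogonal _ _ _).1 hm (toAmbient ι η) ⟨η, rfl⟩
  conv_rhs => rw [← h]
  rw [inner_add_left, h₀, add_zero]
  rfl

/-- The inverse operator `g_x⁻¹`. -/
def inv (g : MetricOperator R ι) (x : M) : E →L[ℝ] E :=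
  (g.op x).inverse

theorem op_inv (g : MetricOperator R ι) (x : M) (v : E) : g.op x (g.inv x v) = v := by
  have hs := LinearMap.surjective_of_injective (f := (g.op x).toLinearMap) (g.injective x)
  have hc : ((ContinuousLinearEquiv.ofBijective (g.op x)
      (LinearMap.ker_eq_bot.2 (g.injective x)) (LinearMap.range_eq_top.2 hs) : E ≃L[ℝ] E) :
      E →L[ℝ] E) = g.op x := ContinuousLinearEquiv.coe_ofBijective _ _ _
  rw [inv, ← hc, ContinuousLinearMap.inverse_equiv]
  simp

end MetricOperator

/-- A Christoffel function of the ambient structure `(M, g, E)`: a smooth function `Γ` from `M` to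
the `E`-valued bilinear forms on `E` with `(∇_X Y)_x = (D_X Y)_x + Γ(X_x, Y_x)` for all smooth
vector fields, `∇` being the Levi-Civita connection of the metric induced by `g`. -/
structure IsChristoffel {R : RiemMetric m M} {ι : M → E} (_g : MetricOperator R ι)
    (Γ : M → E →L[ℝ] E →L[ℝ] E) : Prop where
  smooth : ContMDiff (𝓡 m) 𝓘(ℝ, E →L[ℝ] E →L[ℝ] E) ∞ Γ
  nabla_eq : ∀ cov : Connection m M, IsLeviCivita R cov →
    ∀ X Y : (x : M) → TangentSpace (𝓡 m) x, IsSmoothField X → IsSmoothField Y → ∀ x : M,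
      toAmbient ι (cov Y x (X x)) =
        ambientDeriv ι X Y x + Γ x (toAmbient ι (X x)) (toAmbient ι (Y x))

/-- A smooth function `𝒳` from `M` to the `E`-valued bilinear forms on `E` with
`⟨𝒳(ξ, η), φ⟩ = ⟨(D_φ g) ξ, η⟩` for all tangent vectors `ξ`, `η`, `φ` at the same point. -/
structure IsIndexRaised {R : RiemMetric m M} {ι : M → E} (g : MetricOperator R ι)
    (𝒳 : M → E →L[ℝ] E →L[ℝ] E) : Prop where
  smooth : ContMDiff (𝓡 m) 𝓘(ℝ, E →L[ℝ] E →L[ℝ] E) ∞ 𝒳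
  inner_eq : ∀ (x : M) (ξ η φ : TangentSpace (𝓡 m) x),
    inner ℝ (𝒳 x (toAmbient ι ξ) (toAmbient ι η)) (toAmbient ι φ) =
      inner ℝ (dirDeriv g.op φ (toAmbient ι ξ)) (toAmbient ι η)

end

end AmbientGeometry

end

noncomputable section

namespace AmbientGeometry

open VectorField Set

/-! Let `P_x = g.tangentPart x` be the `g_x`-orthogonal projection of `E` to the tangent space,
followed by the inverse of `dι_x`. In a chart `ι` has an injective derivative `A`, and the normal
equations give `P = (Aᵀ g A)⁻¹ Aᵀ g`. Hence `Π = dι ∘ P` is smooth, and so is `df ∘ P` for every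
smooth `f` (`contMDiff_mvfderiv_tangentPart`). Projecting the direction in this way extends `D g`
and `D Π` to all of `E`, and projecting constant vectors gives a global smooth field through any
tangent vector.

With `K(ξ, η) = ½ g⁻¹((D_ξ g) η + (D_η g) ξ - 𝒳(ξ, η))`, the Koszul formula suggests `∇_ξ Y = P(D_ξ
Y + K(ξ, Y))`. It is torsion-free because second derivatives of `ι` commute (`mvfderiv_mlieBracket`)
and because the tangential part of `K` is symmetric. It is metric by the product rule for `⟨Y, g Z⟩`
(`isLeviCivita_connection`). Uniqueness is the usual argument on the difference tensor
(`leviCivita_unique`).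

Differentiating `Π Y = Y` gives `Π(D_ξ Y) = D_ξ Y - (D_ξ Π) Y`, so that `∇_ξ Y = D_ξ Y - (D_ξ Π) Y +
Π K(ξ, Y)`. This produces a Christoffel function together with the formula (`toAmbient_leviCivita`).
Its values on tangent vectors are forced by the connection, which only sees the Riemannian metric;
off them it can be altered through the normal component `1 - Π`. -/

/-- Differentiability of a vector field at a point. -/
abbrev DiffFieldAt {m : ℕ} {M : Type*} [TopologicalSpace M]
    [ChartedSpace (EuclideanSpace ℝ (Fin m)) M] [IsManifold (𝓡 m) ∞ M]
    (X : (x : M) → TangentSpace (𝓡 m) x) (x : M) :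
    Prop :=
  MDifferentiableAt (𝓡 m) ((𝓡 m).prod 𝓘(ℝ, EuclideanSpace ℝ (Fin m)))
    (fun y => Bundle.TotalSpace.mk' (EuclideanSpace ℝ (Fin m)) y (X y)) x

/-! ### Derivatives in the preferred chart, product rules and the Lie bracket. -/

section Calculus

variable {m : ℕ} {M : Type*} [TopologicalSpace M] [ChartedSpace (EuclideanSpace ℝ (Fin m)) M]
  {F G : Type*} [NormedAddCommGroup F] [NormedSpace ℝ F]
  [NormedAddCommGroup G] [NormedSpace ℝ G]

theorem differentiableAt_comp_extChartAt_symm {h : M → F} {x : M}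
    (hh : MDifferentiableAt (𝓡 m) 𝓘(ℝ, F) h x) :
    DifferentiableAt ℝ (h ∘ (extChartAt (𝓡 m) x).symm) (extChartAt (𝓡 m) x x) := by
  have := hh.differentiableWithinAt_writtenInExtChartAt
  rw [ModelWithCorners.range_eq_univ, differentiableWithinAt_univ] at this
  exact this

theorem mvfderiv_eq_fderiv_comp_extChartAt_symm {h : M → F} {x : M}
    (hh : MDifferentiableAt (𝓡 m) 𝓘(ℝ, F) h x) :
    mvfderiv (𝓡 m) h x =
      fderiv ℝ (h ∘ (extChartAt (𝓡 m) x).symm) (extChartAt (𝓡 m) x x) := by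
  rw [hh.mvfderiv, ModelWithCorners.range_eq_univ, fderivWithin_univ]
  rfl

theorem mvfderiv_clm_comp (L : F →L[ℝ] G) {v : M → F} {x : M}
    (hv : MDifferentiableAt (𝓡 m) 𝓘(ℝ, F) v x)
    (ξ : TangentSpace (𝓡 m) x) :
    mvfderiv (𝓡 m) (fun y => L (v y)) x ξ = L (mvfderiv (𝓡 m) v x ξ) := by
  have hv' := differentiableAt_comp_extChartAt_symm hv
  have : MDifferentiableAt (𝓡 m) 𝓘(ℝ, G) (fun y => L (v y)) x := L.mdifferentiableAt.comp x hv
  rw [mvfderiv_eq_fderiv_comp_extChartAt_symm this, mvfderiv_eq_fderiv_comp_extChartAt_symm hv]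
  have h := (L.hasFDerivAt.comp _ hv'.hasFDerivAt).fderiv
  exact congrArg (fun A : EuclideanSpace ℝ (Fin m) →L[ℝ] G => A ξ) h

theorem mvfderiv_clm_apply {A : M → F →L[ℝ] G} {v : M → F} {x : M}
    (hA : MDifferentiableAt (𝓡 m) 𝓘(ℝ, F →L[ℝ] G) A x)
    (hv : MDifferentiableAt (𝓡 m) 𝓘(ℝ, F) v x) (ξ : TangentSpace (𝓡 m) x) :
    mvfderiv (𝓡 m) (fun y => A y (v y)) x ξ =
      mvfderiv (𝓡 m) A x ξ (v x) + A x (mvfderiv (𝓡 m) v x ξ) := by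
  have hA' := differentiableAt_comp_extChartAt_symm hA
  have hv' := differentiableAt_comp_extChartAt_symm hv
  rw [mvfderiv_eq_fderiv_comp_extChartAt_symm (hA.clm_apply hv),
    mvfderiv_eq_fderiv_comp_extChartAt_symm hv, mvfderiv_eq_fderiv_comp_extChartAt_symm hA]
  have h := congrArg (fun A : EuclideanSpace ℝ (Fin m) →L[ℝ] G => A ξ)
    (hA'.hasFDerivAt.clm_apply hv'.hasFDerivAt).fderiv
  refine h.trans ((add_comm _ _).trans ?_)
  simp only [Function.comp_apply, extChartAt_to_inv]
  rfl

theorem mvfderiv_inner {E : Type*} [NormedAddCommGroup E] [InnerProductSpace ℝ E]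
    {v w : M → E} {x : M} (hv : MDifferentiableAt (𝓡 m) 𝓘(ℝ, E) v x)
    (hw : MDifferentiableAt (𝓡 m) 𝓘(ℝ, E) w x) (ξ : TangentSpace (𝓡 m) x) :
    mvfderiv (𝓡 m) (fun y => inner ℝ (v y) (w y)) x ξ =
      inner ℝ (mvfderiv (𝓡 m) v x ξ) (w x) + inner ℝ (v x) (mvfderiv (𝓡 m) w x ξ) := by
  have hL : MDifferentiableAt (𝓡 m) 𝓘(ℝ, E →L[ℝ] ℝ) (fun y => innerSL ℝ (v y)) x :=
    (innerSL ℝ).mdifferentiableAt.comp x hv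
  have := mvfderiv_clm_apply hL hw ξ
  rw [mvfderiv_clm_comp (innerSL ℝ) hv] at this
  exact this

variable [IsManifold (𝓡 m) ∞ M]

/-- The function is the fibre component of the tangent map of `f`, which is smooth, composed with
the section `W`. -/
theorem mdifferentiableAt_mvfderiv_apply {f : M → F} (hf : ContMDiff (𝓡 m) 𝓘(ℝ, F) ∞ f)
    {W : (x : M) → TangentSpace (𝓡 m) x} {x : M}
    (hW : DiffFieldAt W x) :
    MDifferentiableAt (𝓡 m) 𝓘(ℝ, F) (fun y => mvfderiv (𝓡 m) f y (W y)) x := by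
  have h1 : ContMDiff (𝓡 m).tangent 𝓘(ℝ, F).tangent ∞ (tangentMap (𝓡 m) 𝓘(ℝ, F) f) :=
    hf.contMDiff_tangentMap le_rfl
  have h2 := ((contMDiff_snd_tangentBundle_modelSpace F 𝓘(ℝ, F) (n := ∞)).comp h1)
  have h3 := (h2 (⟨x, W x⟩)).mdifferentiableAt (by simp)
  exact MDifferentiableAt.comp (f := fun y => (⟨y, W y⟩ : TangentBundle (𝓡 m) M)) x h3 hW

/-- A vector field read in the preferred chart at `x`. -/
def coordField (W : (x : M) → TangentSpace (𝓡 m) x) (x : M) :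
    EuclideanSpace ℝ (Fin m) → EuclideanSpace ℝ (Fin m) :=
  mpullbackWithin 𝓘(ℝ, EuclideanSpace ℝ (Fin m)) (𝓡 m) (extChartAt (𝓡 m) x).symm W (range (𝓡 m))

theorem mvfderiv_apply_eq_fderiv_coordField {f : M → F} (hf : ContMDiff (𝓡 m) 𝓘(ℝ, F) ∞ f)
    (W : (x : M) → TangentSpace (𝓡 m) x) (x : M) {u : EuclideanSpace ℝ (Fin m)}
    (hu : u ∈ (extChartAt (𝓡 m) x).target) :
    mvfderiv (𝓡 m) f ((extChartAt (𝓡 m) x).symm u) (W ((extChartAt (𝓡 m) x).symm u)) =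
      fderiv ℝ (f ∘ (extChartAt (𝓡 m) x).symm) u
        (coordField W x u) := by
  have hinv := isInvertible_mfderivWithin_extChartAt_symm (I := 𝓡 m) hu
  have hφ := mdifferentiableWithinAt_extChartAt_symm (I := 𝓡 m) hu
  have hfd := hf.mdifferentiableAt (x := (extChartAt (𝓡 m) x).symm u) (by simp)
  have h := mfderiv_comp_mfderivWithin (s := range (𝓡 m)) u hfd hφ
    (by rw [ModelWithCorners.range_eq_univ]; exact uniqueMDiffWithinAt_univ _)
  have h2 : fderiv ℝ (f ∘ (extChartAt (𝓡 m) x).symm) u =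
      (mfderiv (𝓡 m) 𝓘(ℝ, F) f ((extChartAt (𝓡 m) x).symm u)).comp
      (mfderivWithin 𝓘(ℝ, EuclideanSpace ℝ (Fin m)) (𝓡 m) (extChartAt (𝓡 m) x).symm
        (range (𝓡 m)) u) := by
    rw [← h, mfderivWithin_eq_fderivWithin, ModelWithCorners.range_eq_univ, fderivWithin_univ]
  rw [h2]
  refine (congrArg (mfderiv (𝓡 m) 𝓘(ℝ, F) f ((extChartAt (𝓡 m) x).symm u)) ?_)
  exact (hinv.self_apply_inverse _).symm

theorem contDiffAt_comp_extChartAt_symm {f : M → F} (hf : ContMDiff (𝓡 m) 𝓘(ℝ, F) ∞ f) (x : M) :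
    ContDiffAt ℝ ∞ (f ∘ (extChartAt (𝓡 m) x).symm) (extChartAt (𝓡 m) x x) := by
  have h := (contMDiffOn_extChartAt_symm (I := 𝓡 m) (n := ∞) x).contMDiffAt
    (x := extChartAt (𝓡 m) x x) (extChartAt_target_mem_nhds x)
  exact ((hf _).comp _ h).contDiffAt

/-- The derivative of the preferred chart at its own centre is the identity of the model space. -/
theorem coordField_self (W : (x : M) → TangentSpace (𝓡 m) x) (x : M) :
    coordField W x (extChartAt (𝓡 m) x x) = W x := by
  have h : ∀ z : EuclideanSpace ℝ (Fin m), (mfderivWithin 𝓘(ℝ, EuclideanSpace ℝ (Fin m)) (𝓡 m)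
      (extChartAt (𝓡 m) x).symm (range (𝓡 m)) (extChartAt (𝓡 m) x x)).inverse z = z :=
    fun z => mfderivWithin_extChartAt_symm_inverse_apply (I := 𝓡 m) (x := x) z
  refine (h _).trans ?_
  rw [extChartAt_to_inv]

theorem differentiableAt_coordField
    {W : (x : M) → TangentSpace (𝓡 m) x} {x : M} (hW : DiffFieldAt W x) :
    DifferentiableAt ℝ (coordField W x) (extChartAt (𝓡 m) x x) := by
  -- The derivative is taken within the preimage of `univ` intersected with the range of the model;
  -- without boundary this is everything.
  have h : ∀ S : Set (EuclideanSpace ℝ (Fin m)), S = univ → DifferentiableWithinAt ℝ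
      (coordField W x) S (extChartAt (𝓡 m) x x) →
      DifferentiableAt ℝ (coordField W x) (extChartAt (𝓡 m) x x) := by
    rintro S rfl h
    exact differentiableWithinAt_univ.1 h
  refine h _ ?_ (MDifferentiableWithinAt.differentiableWithinAt_mpullbackWithin_vectorField
    (s := univ) (I := 𝓡 m) (V := W) (x := x) hW.mdifferentiableWithinAt)
  rw [preimage_univ, univ_inter, ModelWithCorners.range_eq_univ]

theorem mlieBracket_eq_lieBracket_coordField (V W : (x : M) → TangentSpace (𝓡 m) x) (x : M) :
    mlieBracket (𝓡 m) V W x =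
      lieBracket ℝ (coordField V x) (coordField W x) (extChartAt (𝓡 m) x x) := by
  have h : ∀ z : EuclideanSpace ℝ (Fin m), (mfderiv (𝓡 m) 𝓘(ℝ, EuclideanSpace ℝ (Fin m))
      (extChartAt (𝓡 m) x) x).inverse z = z := by
    intro z
    rw [mfderiv_extChartAt_self]
    exact congrArg (fun A : EuclideanSpace ℝ (Fin m) →L[ℝ] EuclideanSpace ℝ (Fin m) => A z)
      ContinuousLinearMap.inverse_id
  have h' : ∀ S : Set (EuclideanSpace ℝ (Fin m)), S = univ →
      lieBracketWithin ℝ (coordField V x) (coordField W x) S (extChartAt (𝓡 m) x x) =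
        lieBracket ℝ (coordField V x) (coordField W x) (extChartAt (𝓡 m) x x) := by
    rintro S rfl
    rw [lieBracketWithin_univ]
  refine Eq.trans ?_ (h' ((extChartAt (𝓡 m) x).symm ⁻¹' univ ∩ range (𝓡 m)) ?_)
  · rw [← mlieBracketWithin_univ, mlieBracketWithin_apply]
    exact h _
  · rw [preimage_univ, univ_inter, ModelWithCorners.range_eq_univ]

/-- In the chart, with `D` the derivative of `f`, the product rule turns `V(W f)` into `D'(V) W +
D(W' V)`. The second-order terms cancel by symmetry of the second derivative, and `D(W' V - V' W)`
remains. For `f = ι` this is the torsion identity of the ambient derivative. -/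
theorem mvfderiv_mlieBracket {f : M → F} (hf : ContMDiff (𝓡 m) 𝓘(ℝ, F) ∞ f)
    {V W : (x : M) → TangentSpace (𝓡 m) x} {x : M}
    (hV : DiffFieldAt V x) (hW : DiffFieldAt W x) :
    mvfderiv (𝓡 m) (fun y => mvfderiv (𝓡 m) f y (W y)) x (V x) -
      mvfderiv (𝓡 m) (fun y => mvfderiv (𝓡 m) f y (V y)) x (W x) =
      mvfderiv (𝓡 m) f x (mlieBracket (𝓡 m) V W x) := by
  set φ := extChartAt (𝓡 m) x
  set u := φ x
  set D := fderiv ℝ (f ∘ φ.symm)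
  have hF : ContDiffAt ℝ ∞ (f ∘ φ.symm) u := contDiffAt_comp_extChartAt_symm hf x
  have hsymm : IsSymmSndFDerivAt ℝ (f ∘ φ.symm) u :=
    hF.isSymmSndFDerivAt (by simp only [minSmoothness_of_isRCLikeNormedField]; norm_cast)
  have hDd : DifferentiableAt ℝ D u :=
    (hF.fderiv_right (m := 1) (by norm_cast)).differentiableAt one_ne_zero
  have key : ∀ Z : (x : M) → TangentSpace (𝓡 m) x, DiffFieldAt Z x →
      ∀ ξ : EuclideanSpace ℝ (Fin m),
      mvfderiv (𝓡 m) (fun y => mvfderiv (𝓡 m) f y (Z y)) x ξ =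
        fderiv ℝ D u ξ (coordField Z x u) + D u (fderiv ℝ (coordField Z x) u ξ) := by
    intro Z hZ ξ
    rw [mvfderiv_eq_fderiv_comp_extChartAt_symm (mdifferentiableAt_mvfderiv_apply hf hZ)]
    have he : (fun y => mvfderiv (𝓡 m) f y (Z y)) ∘ φ.symm =ᶠ[𝓝 u]
        fun v => D v (coordField Z x v) := by
      filter_upwards [extChartAt_target_mem_nhds (I := 𝓡 m) x] with v hv
      exact mvfderiv_apply_eq_fderiv_coordField hf Z x hv
    refine (congrArg (fun A : EuclideanSpace ℝ (Fin m) →L[ℝ] F => A ξ)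
      (he.fderiv_eq.trans (hDd.hasFDerivAt.clm_apply
        (differentiableAt_coordField hZ).hasFDerivAt).fderiv)).trans ?_
    exact add_comm _ _
  have e3 : mvfderiv (𝓡 m) f x (mlieBracket (𝓡 m) V W x) =
      D u (lieBracket ℝ (coordField V x) (coordField W x) u) := by
    rw [mvfderiv_eq_fderiv_comp_extChartAt_symm (hf.mdifferentiableAt (by simp)),
      mlieBracket_eq_lieBracket_coordField]
    rfl
  refine (congrArg₂ (· - ·) (key W hW (V x)) (key V hV (W x))).trans (Eq.trans ?_ e3.symm)
  have hVx : coordField V x u = V x := coordField_self V x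
  have hWx : coordField W x u = W x := coordField_self W x
  rw [← hVx, ← hWx, hsymm (coordField V x u) (coordField W x u), lieBracket_eq, map_sub]
  exact add_sub_add_left_eq_sub _ _ _

end Calculus

/-! ### Injectivity of the derivative of an immersion. -/

section Immersion

variable {m : ℕ} {M : Type*} [TopologicalSpace M] [ChartedSpace (EuclideanSpace ℝ (Fin m)) M]
  [IsManifold (𝓡 m) ∞ M] {E : Type*} [NormedAddCommGroup E] [NormedSpace ℝ E]

theorem mdifferentiable_of_mem_maximalAtlas {H : Type*} [NormedAddCommGroup H] [NormedSpace ℝ H]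
    {N : Type*} [TopologicalSpace N] [ChartedSpace H N] [IsManifold 𝓘(ℝ, H) ∞ N]
    {e : OpenPartialHomeomorph N H} (he : e ∈ IsManifold.maximalAtlas 𝓘(ℝ, H) ∞ N) :
    e.MDifferentiable 𝓘(ℝ, H) 𝓘(ℝ, H) :=
  ⟨(contMDiffOn_of_mem_maximalAtlas he).mdifferentiableOn (by simp),
    (contMDiffOn_symm_of_mem_maximalAtlas he).mdifferentiableOn (by simp)⟩

/-- In adapted charts `ι` is the injective linear map `J : u ↦ equiv (u, 0)`. The chain rule on both
sides of `codChart ∘ ι = J ∘ domChart` reduces the claim to injectivity of the derivative of the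
domain chart. -/
theorem injective_mvfderiv_of_isImmersionAt {ι : M → E} {x : M}
    (h : Manifold.IsImmersionAt (𝓡 m) 𝓘(ℝ, E) ∞ ι x) :
    Function.Injective (mvfderiv (𝓡 m) ι x) := by
  rw [injective_iff_map_eq_zero]
  intro ξ hξ
  have hd := mdifferentiable_of_mem_maximalAtlas h.domChart_mem_maximalAtlas
  have hc := mdifferentiable_of_mem_maximalAtlas h.codChart_mem_maximalAtlas
  have hd1 := (hd.mdifferentiableAt h.mem_domChart_source).hasMFDerivAt
  have hc1 := (hc.mdifferentiableAt h.mem_codChart_source).hasMFDerivAt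
  have hι := (h.contMDiffAt.mdifferentiableAt (by simp)).hasMFDerivAt
  let J : EuclideanSpace ℝ (Fin m) →L[ℝ] E :=
    (h.equiv : (EuclideanSpace ℝ (Fin m) × h.complement) →L[ℝ] E).comp
      (ContinuousLinearMap.inl ℝ _ _)
  have hJ : HasMFDerivAt 𝓘(ℝ, EuclideanSpace ℝ (Fin m)) 𝓘(ℝ, E) J (h.domChart x) J :=
    J.hasMFDerivAt
  have h1 := hc1.comp x hι
  have h2 := hJ.comp x hd1
  have he : h.codChart ∘ ι =ᶠ[𝓝 x] J ∘ h.domChart := by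
    filter_upwards [h.domChart.open_source.mem_nhds h.mem_domChart_source] with y hy
    have hy' : h.domChart y ∈ (h.domChart.extend (𝓡 m)).target := by
      simpa using h.domChart.map_source hy
    have := h.writtenInCharts hy'
    simpa [hy, J] using this
  have h3 := hasMFDerivAt_unique h1 (h2.congr_of_eventuallyEq he)
  have h4 := congrArg (fun A : EuclideanSpace ℝ (Fin m) →L[ℝ] E => A ξ) h3
  have hξ' : mfderiv (𝓡 m) 𝓘(ℝ, E) ι x ξ = 0 := hξ
  have h5 : J (mfderiv (𝓡 m) 𝓘(ℝ, EuclideanSpace ℝ (Fin m)) h.domChart x ξ) = 0 := by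
    refine h4.symm.trans ?_
    refine (congrArg (mfderiv 𝓘(ℝ, E) 𝓘(ℝ, E) h.codChart (ι x)) hξ').trans ?_
    exact map_zero _
  have h6 : mfderiv (𝓡 m) 𝓘(ℝ, EuclideanSpace ℝ (Fin m)) h.domChart x ξ = 0 := by
    have := (h.equiv.map_eq_zero_iff).1 h5
    exact congrArg Prod.fst this
  exact (hd.mfderiv_injective h.mem_domChart_source) (h6.trans (map_zero _).symm)

end Immersion

/-! ### Derivatives over varying tangent spaces, read in one fixed chart. -/

section ChartDeriv

variable {m : ℕ} {M : Type*} [TopologicalSpace M] [ChartedSpace (EuclideanSpace ℝ (Fin m)) M]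
  [IsManifold (𝓡 m) ∞ M] {F : Type*} [NormedAddCommGroup F] [NormedSpace ℝ F]

/-- The derivative of `f` at `y`, read in the preferred chart at `x`. -/
def chartDeriv (f : M → F) (x y : M) : EuclideanSpace ℝ (Fin m) →L[ℝ] F :=
  fderiv ℝ (f ∘ (extChartAt (𝓡 m) x).symm) (extChartAt (𝓡 m) x y)

/-- The coordinate frame at `y` of the preferred chart at `x`. -/
def chartFrame (x y : M) : EuclideanSpace ℝ (Fin m) →L[ℝ] TangentSpace (𝓡 m) y :=
  (trivializationAt (EuclideanSpace ℝ (Fin m)) (TangentSpace (𝓡 m)) x).symmL ℝ y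

theorem contMDiffAt_chartDeriv {f : M → F} (hf : ContMDiff (𝓡 m) 𝓘(ℝ, F) ∞ f) (x : M) :
    ContMDiffAt (𝓡 m) 𝓘(ℝ, EuclideanSpace ℝ (Fin m) →L[ℝ] F) ∞ (chartDeriv (m := m) f x) x := by
  have h1 : ContDiffAt ℝ ∞ (fderiv ℝ (f ∘ (extChartAt (𝓡 m) x).symm)) (extChartAt (𝓡 m) x x) :=
    (contDiffAt_comp_extChartAt_symm hf x).fderiv_right (by norm_cast)
  exact h1.contMDiffAt.comp x contMDiffAt_extChartAt

/-- The coordinate frame of the tangent bundle trivialization is the derivative of the inverse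
chart, so this is the chain rule for `f ∘ φ⁻¹`. -/
theorem chartDeriv_apply {f : M → F} (hf : ContMDiff (𝓡 m) 𝓘(ℝ, F) ∞ f) {x y : M}
    (hy : y ∈ (extChartAt (𝓡 m) x).source) (u : EuclideanSpace ℝ (Fin m)) :
    chartDeriv f x y u = mvfderiv (𝓡 m) f y (chartFrame x y u) := by
  have hy' : y ∈ (chartAt (EuclideanSpace ℝ (Fin m)) x).source := by simpa using hy
  have hu := (extChartAt (𝓡 m) x).map_source hy
  have hφ := (mdifferentiableWithinAt_extChartAt_symm (I := 𝓡 m) hu).hasMFDerivWithinAt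
  have hl := (extChartAt (𝓡 m) x).left_inv hy
  have hfd : MDifferentiableAt (𝓡 m) 𝓘(ℝ, F) f
    ((extChartAt (𝓡 m) x).symm (extChartAt (𝓡 m) x y)) := hf.mdifferentiableAt (by simp)
  have h := mfderiv_comp_mfderivWithin (s := range (𝓡 m)) _ hfd hφ.mdifferentiableWithinAt
    (by rw [ModelWithCorners.range_eq_univ]; exact uniqueMDiffWithinAt_univ _)
  have h2 : chartDeriv (m := m) f x y =
      (mfderiv (𝓡 m) 𝓘(ℝ, F) f ((extChartAt (𝓡 m) x).symm (extChartAt (𝓡 m) x y))).comp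
      (mfderivWithin 𝓘(ℝ, EuclideanSpace ℝ (Fin m)) (𝓡 m) (extChartAt (𝓡 m) x).symm
        (range (𝓡 m)) (extChartAt (𝓡 m) x y)) := by
    rw [← h, mfderivWithin_eq_fderivWithin, ModelWithCorners.range_eq_univ, fderivWithin_univ]
    rfl
  rw [h2, chartFrame, TangentBundle.symmL_trivializationAt hy']
  have : ∀ z, z = y → ∀ v : EuclideanSpace ℝ (Fin m),
    (mfderiv (𝓡 m) 𝓘(ℝ, F) f z v : F) = mfderiv (𝓡 m) 𝓘(ℝ, F) f y v := by
    rintro z rfl v; rfl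
  exact this _ hl _

theorem chartFrame_continuousLinearMapAt {x y : M} (hy : y ∈ (extChartAt (𝓡 m) x).source)
    (ξ : TangentSpace (𝓡 m) y) : chartFrame x y ((trivializationAt (EuclideanSpace ℝ (Fin m))
      (TangentSpace (𝓡 m)) x).continuousLinearMapAt ℝ y ξ) = ξ :=
  Bundle.Trivialization.symmL_continuousLinearMapAt _ (by simpa using hy) _

theorem continuousLinearMapAt_chartFrame {x y : M} (hy : y ∈ (extChartAt (𝓡 m) x).source)
    (u : EuclideanSpace ℝ (Fin m)) : (trivializationAt (EuclideanSpace ℝ (Fin m))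
      (TangentSpace (𝓡 m)) x).continuousLinearMapAt ℝ y (chartFrame x y u) = u :=
  Bundle.Trivialization.continuousLinearMapAt_symmL _ (by simpa using hy) _

end ChartDeriv

/-! ### Weighted least squares: a formula for the projection that is smooth in its data. -/

section WeightedInverse

variable {V E : Type*} [NormedAddCommGroup V] [InnerProductSpace ℝ V] [FiniteDimensional ℝ V]
  [NormedAddCommGroup E] [InnerProductSpace ℝ E] [FiniteDimensional ℝ E]

/-- The adjoint, as a linear map. -/
def adjointL : (V →L[ℝ] E) →L[ℝ] (E →L[ℝ] V) :=
  LinearMap.toContinuousLinearMap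
    { toFun := fun A => ContinuousLinearMap.adjoint A
      map_add' := fun A B => map_add _ A B
      map_smul' := fun c A => by simp }

/-- The left inverse `(Aᵀ g A)⁻¹ Aᵀ g` of an injective map `A`. -/
def weightedInverse (A : V →L[ℝ] E) (g : E →L[ℝ] E) : E →L[ℝ] V :=
  (adjointL A ∘L g ∘L A).inverse ∘L adjointL A ∘L g

theorem inner_adjointL (A : V →L[ℝ] E) (v : E) (u : V) :
    inner ℝ u (adjointL A v) = inner ℝ (A u) v :=
  ContinuousLinearMap.adjoint_inner_right A u v

/-- If `Aᵀ g A u = 0`, then `⟨A u, g A u⟩ = 0`, so `A u = 0` by positivity and `u = 0`; in finite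
dimension an injective endomorphism is invertible. -/
theorem isInvertible_gram {A : V →L[ℝ] E} (hA : Function.Injective A) {g : E →L[ℝ] E}
    (hg : ∀ v, v ≠ 0 → 0 < inner ℝ v (g v)) : (adjointL A ∘L g ∘L A).IsInvertible := by
  have hinj : Function.Injective (adjointL A ∘L g ∘L A) := by
    rw [injective_iff_map_eq_zero]
    intro u hu
    by_contra h
    have h1 := hg (A u) (fun h' => h (hA (h'.trans (map_zero A).symm)))
    rw [← inner_adjointL] at h1
    have h2 : adjointL A (g (A u)) = 0 := hu
    rw [h2, inner_zero_right] at h1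
    exact lt_irrefl _ h1
  have hs := LinearMap.surjective_of_injective
    (f := (adjointL A ∘L g ∘L A).toLinearMap) hinj
  exact ⟨ContinuousLinearEquiv.ofBijective _ (LinearMap.ker_eq_bot.2 hinj)
    (LinearMap.range_eq_top.2 hs), ContinuousLinearEquiv.coe_ofBijective _ _ _⟩

/-- These are the normal equations: they characterise `A (weightedInverse A g v)` as the
`g`-orthogonal projection of `v` to the range of `A`. -/
theorem inner_weightedInverse {A : V →L[ℝ] E} (hA : Function.Injective A) {g : E →L[ℝ] E}
    (hg : ∀ v, v ≠ 0 → 0 < inner ℝ v (g v)) (v : E) (u : V) :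
    inner ℝ (A u) (g (A (weightedInverse A g v))) = inner ℝ (A u) (g v) := by
  rw [← inner_adjointL, ← inner_adjointL]
  congr 1
  exact (isInvertible_gram hA hg).self_apply_inverse (adjointL A (g v))

omit [FiniteDimensional ℝ E] in
theorem contMDiffAt_inverse_clm {m : ℕ} {M : Type*} [TopologicalSpace M]
    [ChartedSpace (EuclideanSpace ℝ (Fin m)) M]
    {T : M → V →L[ℝ] E} {x : M} (hT : ContMDiffAt (𝓡 m) 𝓘(ℝ, V →L[ℝ] E) ∞ T x)
    (hi : (T x).IsInvertible) :
    ContMDiffAt (𝓡 m) 𝓘(ℝ, E →L[ℝ] V) ∞ (fun y => (T y).inverse) x := by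
  obtain ⟨e, he⟩ := hi
  have h := contDiffAt_map_inverse (𝕜 := ℝ) (n := ∞) e
  rw [he] at h
  exact h.contMDiffAt.comp x hT

theorem contMDiffAt_weightedInverse {m : ℕ} {M : Type*} [TopologicalSpace M]
    [ChartedSpace (EuclideanSpace ℝ (Fin m)) M]
    {A : M → V →L[ℝ] E} {g : M → E →L[ℝ] E} {x : M}
    (hA : ContMDiffAt (𝓡 m) 𝓘(ℝ, V →L[ℝ] E) ∞ A x)
    (hg : ContMDiffAt (𝓡 m) 𝓘(ℝ, E →L[ℝ] E) ∞ g x)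
    (hi : Function.Injective (A x)) (hp : ∀ v, v ≠ 0 → 0 < inner ℝ v (g x v)) :
    ContMDiffAt (𝓡 m) 𝓘(ℝ, E →L[ℝ] V) ∞ (fun y => weightedInverse (A y) (g y)) x := by
  have h1 : ContMDiffAt (𝓡 m) 𝓘(ℝ, E →L[ℝ] V) ∞ (fun y => adjointL (A y)) x :=
    (adjointL (V := V) (E := E)).contDiff.contMDiff.contMDiffAt.comp x hA
  exact (contMDiffAt_inverse_clm (h1.clm_comp (hg.clm_comp hA))
    (isInvertible_gram hi hp)).clm_comp (h1.clm_comp hg)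

end WeightedInverse

/-! ### Smoothness of operations on operator-valued and bilinear-form-valued maps. -/

theorem contMDiff_clm_apply_const {m : ℕ} {M : Type*} [TopologicalSpace M]
    [ChartedSpace (EuclideanSpace ℝ (Fin m)) M] {F G : Type*} [NormedAddCommGroup F]
    [NormedSpace ℝ F] [NormedAddCommGroup G] [NormedSpace ℝ G] (L : F →L[ℝ] G) {T : M → F}
    (hT : ContMDiff (𝓡 m) 𝓘(ℝ, F) ∞ T) : ContMDiff (𝓡 m) 𝓘(ℝ, G) ∞ (fun x => L (T x)) :=
  L.contDiff.contMDiff.comp hT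

set_option synthInstance.maxHeartbeats 200000 in
theorem contMDiff_postcomp {m : ℕ} {M : Type*} [TopologicalSpace M]
    [ChartedSpace (EuclideanSpace ℝ (Fin m)) M] {F G H : Type*} [NormedAddCommGroup F]
    [NormedSpace ℝ F] [NormedAddCommGroup G] [NormedSpace ℝ G] [NormedAddCommGroup H]
    [NormedSpace ℝ H] {T : M → F →L[ℝ] G} {B : M → H →L[ℝ] H →L[ℝ] F}
    (hT : ContMDiff (𝓡 m) 𝓘(ℝ, F →L[ℝ] G) ∞ T)
    (hB : ContMDiff (𝓡 m) 𝓘(ℝ, H →L[ℝ] H →L[ℝ] F) ∞ B) :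
    ContMDiff (𝓡 m) 𝓘(ℝ, H →L[ℝ] H →L[ℝ] G) ∞
      (fun x => ContinuousLinearMap.compL ℝ H F G (T x) ∘L B x) := by
  have h := contMDiff_clm_apply_const (G := (H →L[ℝ] F) →L[ℝ] (H →L[ℝ] G))
    (ContinuousLinearMap.compL ℝ H F G) hT
  exact h.clm_comp hB

set_option synthInstance.maxHeartbeats 200000 in
theorem contMDiff_flip {m : ℕ} {M : Type*} [TopologicalSpace M]
    [ChartedSpace (EuclideanSpace ℝ (Fin m)) M] {F G : Type*} [NormedAddCommGroup F]
    [NormedSpace ℝ F] [NormedAddCommGroup G] [NormedSpace ℝ G] {B : M → F →L[ℝ] F →L[ℝ] G}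
    (hB : ContMDiff (𝓡 m) 𝓘(ℝ, F →L[ℝ] F →L[ℝ] G) ∞ B) :
    ContMDiff (𝓡 m) 𝓘(ℝ, F →L[ℝ] F →L[ℝ] G) ∞ (fun x => (B x).flip) := by
  have h := contMDiff_clm_apply_const (G := F →L[ℝ] F →L[ℝ] G)
    (ContinuousLinearMap.flipₗᵢ ℝ F F G).toContinuousLinearEquiv.toContinuousLinearMap hB
  exact h

/-! ### The projection to the tangent spaces and its smoothness. -/

section Ambient

variable {m : ℕ} {M : Type*} [TopologicalSpace M] [ChartedSpace (EuclideanSpace ℝ (Fin m)) M]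
  [IsManifold (𝓡 m) ∞ M] {E : Type*} [NormedAddCommGroup E] [InnerProductSpace ℝ E]
  [FiniteDimensional ℝ E] {ι : M → E} {R : RiemMetric m M}

omit [IsManifold (𝓡 m) ∞ M] [FiniteDimensional ℝ E] in
theorem toAmbient_add (ι : M → E) {x : M} (ξ η : TangentSpace (𝓡 m) x) :
    toAmbient ι (ξ + η) = toAmbient ι ξ + toAmbient ι η := map_add _ _ _

omit [IsManifold (𝓡 m) ∞ M] [FiniteDimensional ℝ E] in
theorem toAmbient_smul (ι : M → E) {x : M} (c : ℝ) (ξ : TangentSpace (𝓡 m) x) :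
    toAmbient ι (c • ξ) = c • toAmbient ι ξ := map_smul _ _ _

namespace MetricOperator

variable (g : MetricOperator R ι)

/-- The difference of the two vectors is tangent and `g`-orthogonal to all tangent vectors, hence to
itself. -/
theorem proj_eq_of_inner (x : M) {v p : E} (hp : p ∈ ambientTangent m ι x)
    (h : ∀ η : TangentSpace (𝓡 m) x,
      inner ℝ p (g.op x (toAmbient ι η)) = inner ℝ v (g.op x (toAmbient ι η))) :
    g.proj x v = p := by
  obtain ⟨ζ, hζ⟩ := (ambientTangent m ι x).sub_mem (g.proj_mem x v) hp
  have hζ' : g.proj x v - p = toAmbient ι ζ := hζ.symm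
  refine sub_eq_zero.1 (g.inner_self_eq_zero x ?_)
  nth_rewrite 2 [hζ']
  rw [inner_sub_left, g.inner_proj, h, sub_self]

@[simp] theorem proj_toAmbient (x : M) (ξ : TangentSpace (𝓡 m) x) :
    g.proj x (toAmbient ι ξ) = toAmbient ι ξ :=
  g.proj_eq_of_inner x ⟨ξ, rfl⟩ fun _ => rfl

/-- The tangent vector identified with the projection of `v` to the tangent space. -/
def tangentPart (x : M) : E →L[ℝ] TangentSpace (𝓡 m) x :=
  LinearMap.toContinuousLinearMap
    -- The left inverse is determined only on the range of `dι_x`, so the projection is applied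
    -- first.
    ((mvfderiv (𝓡 m) ι x).toLinearMap.leftInverse ∘ₗ (g.proj x).toLinearMap)

variable (hi : ∀ x, Function.Injective (mvfderiv (𝓡 m) ι x))
include hi

theorem tangentPart_toAmbient (x : M) (ξ : TangentSpace (𝓡 m) x) :
    g.tangentPart x (toAmbient ι ξ) = ξ := by
  have h := LinearMap.leftInverse_apply_of_inj (f := (mvfderiv (𝓡 m) ι x).toLinearMap)
    (LinearMap.ker_eq_bot.2 (hi x)) ξ
  refine Eq.trans ?_ h
  change (mvfderiv (𝓡 m) ι x).toLinearMap.leftInverse (g.proj x (toAmbient ι ξ)) = _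
  rw [proj_toAmbient]
  rfl

theorem toAmbient_tangentPart (x : M) (v : E) :
    toAmbient ι (g.tangentPart x v) = g.proj x v := by
  obtain ⟨ζ, hζ⟩ := g.proj_mem x v
  have hζ' : toAmbient ι ζ = g.proj x v := hζ
  have h1 := g.tangentPart_toAmbient hi x ζ
  have h2 : g.tangentPart x v = g.tangentPart x (toAmbient ι ζ) := by
    change (mvfderiv (𝓡 m) ι x).toLinearMap.leftInverse (g.proj x v) =
      (mvfderiv (𝓡 m) ι x).toLinearMap.leftInverse (g.proj x (toAmbient ι ζ))
    rw [proj_toAmbient, hζ']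
  rw [h2, h1, hζ']

theorem inner_tangentPart (x : M) (v : E) (η : TangentSpace (𝓡 m) x) :
    R.inner x (g.tangentPart x v) η = inner ℝ v (g.op x (toAmbient ι η)) := by
  rw [g.induces, g.toAmbient_tangentPart hi, g.inner_proj]

variable (hs : ContMDiff (𝓡 m) 𝓘(ℝ, E) ∞ ι)
include hs

omit [FiniteDimensional ℝ E] in
theorem injective_chartDeriv {x y : M} (hy : y ∈ (extChartAt (𝓡 m) x).source) :
    Function.Injective (chartDeriv (m := m) ι x y) := by
  intro u v huv
  rw [chartDeriv_apply hs hy, chartDeriv_apply hs hy] at huv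
  have := congrArg ((trivializationAt (EuclideanSpace ℝ (Fin m))
      (TangentSpace (𝓡 m)) x).continuousLinearMapAt ℝ y) (hi y huv)
  rwa [continuousLinearMapAt_chartFrame hy, continuousLinearMapAt_chartFrame hy] at this

/-- After applying the injective `dι_y`, both sides are the `g_y`-projection of `v`. The right side
shows the smooth dependence on `y`. -/
theorem tangentPart_eq_chartFrame {x y : M} (hy : y ∈ (extChartAt (𝓡 m) x).source) (v : E) :
    g.tangentPart y v = chartFrame x y (weightedInverse (chartDeriv ι x y) (g.op y) v) := by
  apply hi y
  refine (g.toAmbient_tangentPart hi y v).trans ?_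
  refine g.proj_eq_of_inner y ⟨_, rfl⟩ fun η => ?_
  obtain ⟨u, rfl⟩ : ∃ u, chartFrame x y u = η := ⟨_, chartFrame_continuousLinearMapAt hy η⟩
  have h := inner_weightedInverse (injective_chartDeriv hi hs hy) (g.pos y) v u
  rw [chartDeriv_apply hs hy, chartDeriv_apply hs hy] at h
  rw [← g.symm, real_inner_comm, ← g.symm y v, real_inner_comm (toAmbient ι _) (g.op y v)]
  exact h

/-- The frame is absorbed into `chartDeriv f`, leaving a composition of smooth maps between fixed
spaces. It is used with `f` equal to `ι`, `g.op` and `g.proj`. -/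
theorem contMDiff_mvfderiv_tangentPart {F : Type*} [NormedAddCommGroup F] [NormedSpace ℝ F]
    {f : M → F} (hf : ContMDiff (𝓡 m) 𝓘(ℝ, F) ∞ f) :
    ContMDiff (𝓡 m) 𝓘(ℝ, E →L[ℝ] F) ∞
      (fun x => mvfderiv (𝓡 m) f x ∘L g.tangentPart x) := by
  intro x
  have hx := mem_extChartAt_source (I := 𝓡 m) x
  have h := (contMDiffAt_chartDeriv hf x).clm_comp
    (contMDiffAt_weightedInverse (contMDiffAt_chartDeriv hs x) (g.smooth x)
      (injective_chartDeriv hi hs hx) (g.pos x))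
  refine h.congr_of_eventuallyEq ?_
  filter_upwards [extChartAt_source_mem_nhds (I := 𝓡 m) x] with y hy
  ext v
  simp only [ContinuousLinearMap.comp_apply]
  rw [g.tangentPart_eq_chartFrame hi hs hy, chartDeriv_apply hf hy]

theorem contMDiff_proj : ContMDiff (𝓡 m) 𝓘(ℝ, E →L[ℝ] E) ∞ g.proj := by
  have h := g.contMDiff_mvfderiv_tangentPart hi hs hs
  refine h.congr fun x => ?_
  ext v
  exact (g.toAmbient_tangentPart hi x v).symm

theorem isSmoothField_tangentPart (v : E) : IsSmoothField (fun x => g.tangentPart x v) := by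
  intro x
  have hx := mem_extChartAt_source (I := 𝓡 m) x
  refine (Bundle.contMDiffAt_section _).2 ?_
  have h := (contMDiffAt_weightedInverse (contMDiffAt_chartDeriv hs x) (g.smooth x)
      (injective_chartDeriv hi hs hx) (g.pos x)).clm_apply
      (contMDiffAt_const (c := v))
  refine h.congr_of_eventuallyEq ?_
  filter_upwards [extChartAt_source_mem_nhds (I := 𝓡 m) x] with y hy
  rw [g.tangentPart_eq_chartFrame hi hs hy]
  have h2 := continuousLinearMapAt_chartFrame hy (weightedInverse (chartDeriv ι x y) (g.op y) v)
  rw [Bundle.Trivialization.continuousLinearMapAt_apply,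
    Bundle.Trivialization.linearMapAt_apply, if_pos (by simpa using hy)] at h2
  exact h2

/-! ### The Koszul term and the candidate Christoffel function on all of `E`. -/

omit hi hs

theorem contMDiff_inv : ContMDiff (𝓡 m) 𝓘(ℝ, E →L[ℝ] E) ∞ g.inv := by
  intro x
  refine contMDiffAt_inverse_clm (g.smooth x) ?_
  have hsurj := LinearMap.surjective_of_injective (f := (g.op x).toLinearMap) (g.injective x)
  exact ⟨ContinuousLinearEquiv.ofBijective (g.op x)
      (LinearMap.ker_eq_bot.2 (g.injective x)) (LinearMap.range_eq_top.2 hsurj),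
      ContinuousLinearEquiv.coe_ofBijective _ _ _⟩

/-- The derivative `(v, w) ↦ (D_v g) w` of the metric operator, extended to the ambient space by
projecting `v`. -/
def derivOp (x : M) : E →L[ℝ] E →L[ℝ] E := mvfderiv (𝓡 m) g.op x ∘L g.tangentPart x

/-- The derivative `(v, w) ↦ (D_v Π) w` of the projection, extended to the ambient space by
projecting `v`. -/
def derivProj (x : M) : E →L[ℝ] E →L[ℝ] E := mvfderiv (𝓡 m) g.proj x ∘L g.tangentPart x

/-- The inner product of `v` and `w` times a fixed vector `b`, as a bilinear map. -/
def innerSMul (b : E) : E →L[ℝ] E →L[ℝ] E :=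
  ((ContinuousLinearMap.smulRightL ℝ E E).flip b) ∘L innerSL ℝ

omit [FiniteDimensional ℝ E] in
theorem innerSMul_apply (b v w : E) : innerSMul b v w = inner ℝ v w • b := rfl

/-- An index-raised term of the metric operator. -/
def indexRaised (x : M) : E →L[ℝ] E →L[ℝ] E :=
  ∑ i, innerSMul (stdOrthonormalBasis ℝ E i) ∘L g.derivOp x (stdOrthonormalBasis ℝ E i)

/-- The bilinear form `½ g⁻¹ (D_v g w + D_w g v - 𝒳(v, w))`. -/
def koszulTerm (𝒳 : M → E →L[ℝ] E →L[ℝ] E) (x : M) : E →L[ℝ] E →L[ℝ] E :=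
  (1 / 2 : ℝ) • (ContinuousLinearMap.compL ℝ E E E (g.inv x) ∘L
    (g.derivOp x + (g.derivOp x).flip - 𝒳 x))

theorem koszulTerm_apply (𝒳 : M → E →L[ℝ] E →L[ℝ] E) (x : M) (v w : E) :
    g.koszulTerm 𝒳 x v w =
      (1 / 2 : ℝ) • g.inv x (g.derivOp x v w + g.derivOp x w v - 𝒳 x v w) := rfl

/-- A Christoffel function of the metric operator. -/
def christoffel (𝒳 : M → E →L[ℝ] E →L[ℝ] E) (x : M) : E →L[ℝ] E →L[ℝ] E :=
  ContinuousLinearMap.compL ℝ E E E (g.proj x) ∘L g.koszulTerm 𝒳 x - g.derivProj x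

theorem christoffel_apply (𝒳 : M → E →L[ℝ] E →L[ℝ] E) (x : M) (v w : E) :
    g.christoffel 𝒳 x v w = g.proj x (g.koszulTerm 𝒳 x v w) - g.derivProj x v w := rfl

section
include hi

theorem derivOp_toAmbient (x : M) (ξ : TangentSpace (𝓡 m) x) :
    g.derivOp x (toAmbient ι ξ) = dirDeriv g.op ξ := by
  rw [derivOp, ContinuousLinearMap.comp_apply, g.tangentPart_toAmbient hi]
  rfl

theorem derivProj_toAmbient (x : M) (ξ : TangentSpace (𝓡 m) x) :
    g.derivProj x (toAmbient ι ξ) = dirDeriv g.proj ξ := by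
  rw [derivProj, ContinuousLinearMap.comp_apply, g.tangentPart_toAmbient hi]
  rfl

/-- `indexRaised` is the Riesz vector of the functional `u ↦ ⟨(D_{P u} g) v, w⟩` written in an
orthonormal basis; expanding the tangent vector in that basis recovers the functional. -/
theorem inner_indexRaised (x : M) (v w : E) (φ : TangentSpace (𝓡 m) x) :
    inner ℝ (g.indexRaised x v w) (toAmbient ι φ) = inner ℝ (dirDeriv g.op φ v) w := by
  rw [← g.derivOp_toAmbient hi, indexRaised]
  simp only [sum_apply, ContinuousLinearMap.comp_apply, innerSMul_apply,
    sum_inner, real_inner_smul_left]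
  conv_rhs => rw [← (stdOrthonormalBasis ℝ E).sum_repr' (toAmbient ι φ)]
  simp only [map_sum, map_smul, sum_apply, smul_apply,
    sum_inner, real_inner_smul_left]
  exact Finset.sum_congr rfl fun i _ => mul_comm _ _

variable (hs : ContMDiff (𝓡 m) 𝓘(ℝ, E) ∞ ι)
include hs

theorem contMDiff_derivOp : ContMDiff (𝓡 m) 𝓘(ℝ, E →L[ℝ] E →L[ℝ] E) ∞ g.derivOp :=
  g.contMDiff_mvfderiv_tangentPart hi hs g.smooth

theorem contMDiff_derivProj : ContMDiff (𝓡 m) 𝓘(ℝ, E →L[ℝ] E →L[ℝ] E) ∞ g.derivProj :=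
  g.contMDiff_mvfderiv_tangentPart hi hs (g.contMDiff_proj hi hs)

theorem isIndexRaised_indexRaised : IsIndexRaised g g.indexRaised where
  smooth := by
    refine ContMDiff.congr (f := fun x => ∑ i, innerSMul (stdOrthonormalBasis ℝ E i) ∘L
      g.derivOp x (stdOrthonormalBasis ℝ E i)) ?_ fun x => rfl
    refine contMDiff_finsetSum fun i _ => ?_
    exact contMDiff_const.clm_comp ((g.contMDiff_derivOp hi hs).clm_apply contMDiff_const)
  inner_eq x ξ η φ := g.inner_indexRaised hi x _ _ φ

theorem contMDiff_christoffel {𝒳 : M → E →L[ℝ] E →L[ℝ] E}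
    (h𝒳 : ContMDiff (𝓡 m) 𝓘(ℝ, E →L[ℝ] E →L[ℝ] E) ∞ 𝒳) :
    ContMDiff (𝓡 m) 𝓘(ℝ, E →L[ℝ] E →L[ℝ] E) ∞ (g.christoffel 𝒳) := by
  have hG := g.contMDiff_derivOp hi hs
  have hGf : ContMDiff (𝓡 m) 𝓘(ℝ, E →L[ℝ] E →L[ℝ] E) ∞ (fun x => (g.derivOp x).flip) :=
    contMDiff_flip hG
  have hK : ContMDiff (𝓡 m) 𝓘(ℝ, E →L[ℝ] E →L[ℝ] E) ∞ (g.koszulTerm 𝒳) :=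
    ContMDiff.congr (ContMDiff.smul (contMDiff_const (I' := 𝓘(ℝ, ℝ)) (c := (1 / 2 : ℝ)))
      (contMDiff_postcomp g.contMDiff_inv ((hG.add hGf).sub h𝒳))) fun _ => rfl
  exact (contMDiff_postcomp (g.contMDiff_proj hi hs) hK).sub (g.contMDiff_derivProj hi hs)

end

end MetricOperator

end Ambient

/-! ### The Levi-Civita conditions as pointwise identities. -/

section LeviCivita

variable {m : ℕ} {M : Type*} [TopologicalSpace M] [ChartedSpace (EuclideanSpace ℝ (Fin m)) M]
  [IsManifold (𝓡 m) ∞ M] {R : RiemMetric m M}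

/-- Expresses metric compatibility through `R.inner`, without the Riemannian bundle structure that
is local to the definition. -/
theorem isLeviCivita_iff {cov : Connection m M} :
    IsLeviCivita R cov ↔
      (∀ {X Y : (x : M) → TangentSpace (𝓡 m) x} {x : M}, DiffFieldAt X x → DiffFieldAt Y x →
        cov Y x (X x) - cov X x (Y x) = mlieBracket (𝓡 m) X Y x) ∧
      (∀ {X Y Z : (x : M) → TangentSpace (𝓡 m) x} {x : M}, DiffFieldAt X x → DiffFieldAt Y x →
        DiffFieldAt Z x → mvfderiv (𝓡 m) (fun y => R.inner y (Y y) (Z y)) x (X x) =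
          R.inner x (cov Y x (X x)) (Z x) + R.inner x (Y x) (cov Z x (X x))) := by
  unfold IsLeviCivita
  refine and_congr ?_ ?_
  · rw [CovariantDerivative.torsion_eq_zero_iff]
  · let : Bundle.RiemannianBundle (fun x : M => TangentSpace (𝓡 m) x) := ⟨R.toRiemannianMetric⟩
    have : IsContMDiffRiemannianBundle (𝓡 m) 1 (EuclideanSpace ℝ (Fin m))
        (fun x : M => TangentSpace (𝓡 m) x) :=
      IsContMDiffRiemannianBundle.of_le (n := ∞) (by norm_cast)
    have := CovariantDerivative.isMetricCompatible_iff (I := 𝓡 m)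
      (F := EuclideanSpace ℝ (Fin m)) (V := fun x : M => TangentSpace (𝓡 m) x) (cov := cov)
    refine this.trans ⟨fun h X Y Z x hX hY hZ => h hX hY hZ, fun h x X Y Z hX hY hZ => h hX hY hZ⟩

end LeviCivita

/-! ### The connection, its uniqueness and the Christoffel functions. -/

section Ambient

variable {m : ℕ} {M : Type*} [TopologicalSpace M] [ChartedSpace (EuclideanSpace ℝ (Fin m)) M]
  [IsManifold (𝓡 m) ∞ M] {E : Type*} [NormedAddCommGroup E] [InnerProductSpace ℝ E]
  [FiniteDimensional ℝ E] {ι : M → E} {R : RiemMetric m M}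

theorem IsSmoothField.diffFieldAt {X : (x : M) → TangentSpace (𝓡 m) x} (hX : IsSmoothField X)
    (x : M) : DiffFieldAt X x :=
  (hX x).mdifferentiableAt (by simp)

namespace MetricOperator

variable (g : MetricOperator R ι)

omit [FiniteDimensional ℝ E] in
theorem mdifferentiableAt_op (x : M) : MDifferentiableAt (𝓡 m) 𝓘(ℝ, E →L[ℝ] E) g.op x :=
  (g.smooth x).mdifferentiableAt (by simp)

-- Differentiate `⟨g v, w⟩ = ⟨g w, v⟩` with `v` and `w` constant.
omit [FiniteDimensional ℝ E] in
theorem inner_dirDeriv_op_comm {x : M} (ξ : TangentSpace (𝓡 m) x) (v w : E) :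
    inner ℝ (dirDeriv g.op ξ v) w = inner ℝ (dirDeriv g.op ξ w) v := by
  have hc (v : E) : MDifferentiableAt (𝓡 m) 𝓘(ℝ, E) (fun _ : M => v) x :=
    mdifferentiableAt_const
  have h (v w : E) : mvfderiv (𝓡 m) (fun y => inner ℝ (g.op y v) w) x ξ =
      inner ℝ (dirDeriv g.op ξ v) w := by
    rw [mvfderiv_inner ((g.mdifferentiableAt_op x).clm_apply (hc v)) (hc w),
      mvfderiv_clm_apply (g.mdifferentiableAt_op x) (hc v)]
    simp [mvfderiv_const, dirDeriv]
  rw [← h, ← h]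
  congr 2
  ext y
  rw [g.symm, real_inner_comm]

/-- Pairing against `g ζ` cancels `g⁻¹` and leaves the Christoffel symbols of the first kind. -/
theorem inner_koszulTerm (hi : ∀ x, Function.Injective (mvfderiv (𝓡 m) ι x))
    {𝒳 : M → E →L[ℝ] E →L[ℝ] E} (h𝒳 : IsIndexRaised g 𝒳)
    {x : M} (ξ η ζ : TangentSpace (𝓡 m) x) :
    inner ℝ (g.koszulTerm 𝒳 x (toAmbient ι ξ) (toAmbient ι η)) (g.op x (toAmbient ι ζ)) =
      (1 / 2 : ℝ) * (inner ℝ (dirDeriv g.op ξ (toAmbient ι η)) (toAmbient ι ζ) +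
        inner ℝ (dirDeriv g.op η (toAmbient ι ξ)) (toAmbient ι ζ) -
        inner ℝ (dirDeriv g.op ζ (toAmbient ι ξ)) (toAmbient ι η)) := by
  rw [koszulTerm_apply, real_inner_smul_left, ← g.symm, g.op_inv, inner_sub_left, inner_add_left,
    h𝒳.inner_eq, g.derivOp_toAmbient hi, g.derivOp_toAmbient hi]

variable (hi : ∀ x, Function.Injective (mvfderiv (𝓡 m) ι x))
include g hi

theorem tangentPart_eq_of_inner {x : M} {v w : E}
    (h : ∀ ζ : TangentSpace (𝓡 m) x,
      inner ℝ v (g.op x (toAmbient ι ζ)) = inner ℝ w (g.op x (toAmbient ι ζ))) :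
    g.tangentPart x v = g.tangentPart x w := by
  apply hi x
  refine (g.toAmbient_tangentPart hi x v).trans
    (Eq.trans ?_ (g.toAmbient_tangentPart hi x w).symm)
  exact g.proj_eq_of_inner x (g.proj_mem x w) fun ζ => by rw [g.inner_proj, h]

omit [FiniteDimensional ℝ E] in
theorem eq_zero_of_inner {x : M} {ξ : TangentSpace (𝓡 m) x}
    (h : ∀ ζ : TangentSpace (𝓡 m) x, R.inner x ξ ζ = 0) : ξ = 0 := by
  apply hi x
  rw [map_zero]
  refine g.inner_self_eq_zero x (v := toAmbient ι ξ) ?_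
  rw [← g.induces, h]

/-- Only the tangential components of `𝒳` are prescribed, so symmetry is claimed only after
projecting; there it follows from self-adjointness of `D_ζ g`. -/
theorem tangentPart_koszulTerm_comm {𝒳 : M → E →L[ℝ] E →L[ℝ] E} (h𝒳 : IsIndexRaised g 𝒳)
    {x : M} (ξ η : TangentSpace (𝓡 m) x) :
    g.tangentPart x (g.koszulTerm 𝒳 x (toAmbient ι ξ) (toAmbient ι η)) =
      g.tangentPart x (g.koszulTerm 𝒳 x (toAmbient ι η) (toAmbient ι ξ)) := by
  refine g.tangentPart_eq_of_inner hi fun ζ => ?_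
  rw [g.inner_koszulTerm hi h𝒳, g.inner_koszulTerm hi h𝒳, g.inner_dirDeriv_op_comm ζ]
  ring

/-- The Levi-Civita connection, computed from the ambient derivative and the Koszul term. -/
def connection (hi : ∀ x, Function.Injective (mvfderiv (𝓡 m) ι x))
    (hs : ContMDiff (𝓡 m) 𝓘(ℝ, E) ∞ ι) (𝒳 : M → E →L[ℝ] E →L[ℝ] E) : Connection m M where
  toFun Y x := g.tangentPart x ∘L (mvfderiv (𝓡 m) (fun y => toAmbient ι (Y y)) x +
    (g.koszulTerm 𝒳 x).flip (toAmbient ι (Y x)) ∘L mvfderiv (𝓡 m) ι x)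
  isCovariantDerivativeOnUniv :=
    { add := by
        intro Y Y' x hY hY' _
        have h := mvfderiv_add (mdifferentiableAt_mvfderiv_apply hs hY)
          (mdifferentiableAt_mvfderiv_apply hs hY')
        have h' : (fun y => toAmbient ι ((Y + Y') y)) =
            (fun y => mvfderiv (𝓡 m) ι y (Y y)) + fun y => mvfderiv (𝓡 m) ι y (Y' y) :=
          funext fun y => toAmbient_add ι _ _
        rw [h', h, ← ContinuousLinearMap.comp_add, Pi.add_apply, toAmbient_add, map_add,
          ContinuousLinearMap.add_comp]
        congr 1
        simp only [toAmbient]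
        abel
      leibniz := by
        intro Y f x hY hf _
        have h := mvfderiv_smul hf (mdifferentiableAt_mvfderiv_apply hs hY)
        have h' : (fun y => toAmbient ι ((f • Y) y)) =
            f • (fun y => mvfderiv (𝓡 m) ι y (Y y)) :=
          funext fun y => toAmbient_smul ι _ _
        rw [← h'] at h
        ext1 ξ
        have hξ : mvfderiv (𝓡 m) (fun y => toAmbient ι ((f • Y) y)) x ξ =
            f x • mvfderiv (𝓡 m) (fun y => toAmbient ι (Y y)) x ξ +
              mvfderiv (𝓡 m) f x ξ • toAmbient ι (Y x) := by
          rw [h]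
          rfl
        change g.tangentPart x (mvfderiv (𝓡 m) (fun y => toAmbient ι ((f • Y) y)) x ξ +
            g.koszulTerm 𝒳 x (toAmbient ι ξ) (toAmbient ι (f x • Y x))) =
          f x • g.tangentPart x (mvfderiv (𝓡 m) (fun y => toAmbient ι (Y y)) x ξ +
            g.koszulTerm 𝒳 x (toAmbient ι ξ) (toAmbient ι (Y x))) + mvfderiv (𝓡 m) f x ξ • Y x
        -- The extra term `df(ξ) • ι_* Y` of the product rule is tangent, so `P` returns `df(ξ) •
        -- Y`; the Koszul term is linear in `Y x`.
        rw [hξ, toAmbient_smul, map_smul, add_right_comm, ← smul_add, map_add, map_smul, map_smul,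
          g.tangentPart_toAmbient hi] }

variable (hs : ContMDiff (𝓡 m) 𝓘(ℝ, E) ∞ ι)
include hs

theorem connection_apply (𝒳 : M → E →L[ℝ] E →L[ℝ] E) (Y : (x : M) → TangentSpace (𝓡 m) x) (x : M)
    (ξ : TangentSpace (𝓡 m) x) : g.connection hi hs 𝒳 Y x ξ =
      g.tangentPart x (mvfderiv (𝓡 m) (fun y => toAmbient ι (Y y)) x ξ +
        g.koszulTerm 𝒳 x (toAmbient ι ξ) (toAmbient ι (Y x))) := rfl

/-- For compatibility, the Koszul contributions of `(Y, Z)` and `(Z, Y)` add up to `⟨(D_X g) Y, Z⟩`,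
since the other derivatives of `g` cancel. This is the middle term of the product rule for `⟨Y, g
Z⟩`. -/
theorem isLeviCivita_connection {𝒳 : M → E →L[ℝ] E →L[ℝ] E} (h𝒳 : IsIndexRaised g 𝒳) :
    IsLeviCivita R (g.connection hi hs 𝒳) := by
  refine isLeviCivita_iff.2 ⟨fun {X Y x} hX hY => ?_, fun {X Y Z x} hX hY hZ => ?_⟩
  · rw [connection_apply, connection_apply, map_add, map_add,
      g.tangentPart_koszulTerm_comm hi h𝒳, add_sub_add_right_eq_sub, ← map_sub]
    have h := mvfderiv_mlieBracket hs hX hY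
    refine (congrArg (g.tangentPart x) h).trans ?_
    exact g.tangentPart_toAmbient hi x _
  · have hY' := mdifferentiableAt_mvfderiv_apply hs hY
    have hZ' := mdifferentiableAt_mvfderiv_apply hs hZ
    have h1 := mvfderiv_inner hY' ((g.mdifferentiableAt_op x).clm_apply hZ') (X x)
    rw [mvfderiv_clm_apply (g.mdifferentiableAt_op x) hZ'] at h1
    have h0 : (fun y => R.inner y (Y y) (Z y)) = fun y =>
        inner ℝ (mvfderiv (𝓡 m) ι y (Y y)) (g.op y (mvfderiv (𝓡 m) ι y (Z y))) :=
      funext fun y => g.induces y _ _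
    rw [h0, h1, R.symm x (Y x), connection_apply, connection_apply, g.inner_tangentPart hi,
      g.inner_tangentPart hi, inner_add_left, inner_add_left, g.inner_koszulTerm hi h𝒳,
      g.inner_koszulTerm hi h𝒳, inner_add_right]
    have e1 := g.inner_dirDeriv_op_comm (X x) (toAmbient ι (Z x)) (toAmbient ι (Y x))
    have e4 : inner ℝ (toAmbient ι (Y x)) (dirDeriv g.op (X x) (toAmbient ι (Z x))) =
      inner ℝ (dirDeriv g.op (X x) (toAmbient ι (Z x))) (toAmbient ι (Y x)) :=
      real_inner_comm _ _
    have e5 : inner ℝ (toAmbient ι (Y x)) (g.op x (mvfderiv (𝓡 m)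
        (fun y => toAmbient ι (Z y)) x (X x))) = inner ℝ (mvfderiv (𝓡 m)
        (fun y => toAmbient ι (Z y)) x (X x)) (g.op x (toAmbient ι (Y x))) := by
      rw [← g.symm, real_inner_comm]
    simp only [toAmbient, dirDeriv] at e1 e4 e5 ⊢
    rw [e4, e5, e1]
    ring

theorem exists_smoothField {x : M} (ξ : TangentSpace (𝓡 m) x) :
    ∃ X : (x : M) → TangentSpace (𝓡 m) x, IsSmoothField X ∧ X x = ξ :=
  ⟨_, g.isSmoothField_tangentPart hi hs (toAmbient ι ξ), g.tangentPart_toAmbient hi x ξ⟩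

/-- The difference tensor is symmetric by vanishing torsion and skew by metric compatibility, hence
zero. `Y` must be differentiable because the axioms of a connection constrain only such fields. -/
theorem leviCivita_unique {cov cov' : Connection m M} (h : IsLeviCivita R cov)
    (h' : IsLeviCivita R cov') {Y : (x : M) → TangentSpace (𝓡 m) x} {x : M}
    (hY : DiffFieldAt Y x) : cov Y x = cov' Y x := by
  rw [isLeviCivita_iff] at h h'
  let A := cov.difference cov' x
  have hA {Y : (x : M) → TangentSpace (𝓡 m) x} (hY : DiffFieldAt Y x) :
      A (Y x) = cov Y x - cov' Y x :=
    IsCovariantDerivativeOn.difference_apply cov.isCovariantDerivativeOnUniv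
      cov'.isCovariantDerivativeOnUniv (mem_univ x) hY
  have hsymm (ξ η : TangentSpace (𝓡 m) x) : A ξ η = A η ξ := by
    obtain ⟨X, hX, rfl⟩ := g.exists_smoothField hi hs ξ
    obtain ⟨Y, hY, rfl⟩ := g.exists_smoothField hi hs η
    have hX := hX.diffFieldAt x
    have hY := hY.diffFieldAt x
    rw [hA hX, hA hY, sub_apply, sub_apply]
    have h1 := (h.1 hX hY).trans (h'.1 hX hY).symm
    rw [sub_eq_sub_iff_sub_eq_sub] at h1
    exact h1.symm
  have hanti (ξ η ζ : TangentSpace (𝓡 m) x) :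
      R.inner x (A ξ η) ζ = - R.inner x (A ζ η) ξ := by
    obtain ⟨X, hX, rfl⟩ := g.exists_smoothField hi hs ξ
    obtain ⟨Y, hY, rfl⟩ := g.exists_smoothField hi hs η
    obtain ⟨Z, hZ, rfl⟩ := g.exists_smoothField hi hs ζ
    have hX := hX.diffFieldAt x
    have hY := hY.diffFieldAt x
    have hZ := hZ.diffFieldAt x
    have h1 := (h.2 hY hX hZ).symm.trans (h'.2 hY hX hZ)
    rw [R.symm x (X x), R.symm x (X x)] at h1
    rw [hA hX, hA hZ, sub_apply, sub_apply, map_sub, map_sub, sub_apply, sub_apply]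
    linarith
  have hzero : A (Y x) = 0 := by
    ext1 ξ
    refine g.eq_zero_of_inner hi fun ζ => ?_
    -- For `T(a, b, c) = R(A a b, c)`, symmetric in `a, b` and skew in `a, c`, three sign changes
    -- lead back to the start, so `T = -T`.
    have e1 := hanti (Y x) ξ ζ
    have e2 := hanti ξ ζ (Y x)
    have e3 := hanti ζ (Y x) ξ
    rw [hsymm ζ ξ] at e1
    rw [hsymm (Y x) ζ] at e2
    rw [hsymm ξ (Y x)] at e3
    linarith
  exact sub_eq_zero.1 ((hA hY).symm.trans hzero)

/-- The derivative of `Π Y = Y` trades `Π(D_ξ Y)` for `D_ξ Y - (D_ξ Π) Y`. -/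
theorem toAmbient_leviCivita {𝒳 : M → E →L[ℝ] E →L[ℝ] E} (h𝒳 : IsIndexRaised g 𝒳)
    {cov : Connection m M} (h : IsLeviCivita R cov) {Y : (x : M) → TangentSpace (𝓡 m) x} {x : M}
    (hY : DiffFieldAt Y x) (ξ : TangentSpace (𝓡 m) x) :
    toAmbient ι (cov Y x ξ) = dirDeriv (fun y => toAmbient ι (Y y)) ξ +
      g.christoffel 𝒳 x (toAmbient ι ξ) (toAmbient ι (Y x)) := by
  rw [g.leviCivita_unique hi hs h (g.isLeviCivita_connection hi hs h𝒳) hY, connection_apply,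
    g.toAmbient_tangentPart hi, map_add, christoffel_apply, g.derivProj_toAmbient hi]
  have hY' := mdifferentiableAt_mvfderiv_apply hs hY
  have hp : MDifferentiableAt (𝓡 m) 𝓘(ℝ, E →L[ℝ] E) g.proj x :=
    (g.contMDiff_proj hi hs x).mdifferentiableAt (by simp)
  have h1 := mvfderiv_clm_apply hp hY' ξ
  have h2 : (fun y => g.proj y (mvfderiv (𝓡 m) ι y (Y y))) = fun y => toAmbient ι (Y y) :=
    funext fun y => g.proj_toAmbient y (Y y)
  rw [h2] at h1
  have h3 : dirDeriv (fun y => toAmbient ι (Y y)) ξ = dirDeriv g.proj ξ (toAmbient ι (Y x)) +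
      g.proj x (mvfderiv (𝓡 m) (fun y => toAmbient ι (Y y)) x ξ) := h1
  rw [h3]
  abel

theorem isChristoffel_christoffel {𝒳 : M → E →L[ℝ] E →L[ℝ] E} (h𝒳 : IsIndexRaised g 𝒳) :
    IsChristoffel g (g.christoffel 𝒳) where
  smooth := g.contMDiff_christoffel hi hs h𝒳.smooth
  nabla_eq _ hcov _ _ _ hY x := g.toAmbient_leviCivita hi hs h𝒳 hcov (hY.diffFieldAt x) _

/-- Existence of a Levi-Civita connection is essential: `IsChristoffel` quantifies over all of them
and would otherwise say nothing about values. -/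
theorem christoffel_eq {Γ 𝒳 : M → E →L[ℝ] E →L[ℝ] E} (hΓ : IsChristoffel g Γ)
    (h𝒳 : IsIndexRaised g 𝒳) (x : M) (ξ η : TangentSpace (𝓡 m) x) :
    Γ x (toAmbient ι ξ) (toAmbient ι η) =
      g.christoffel 𝒳 x (toAmbient ι ξ) (toAmbient ι η) := by
  obtain ⟨X, hX, rfl⟩ := g.exists_smoothField hi hs ξ
  obtain ⟨Y, hY, rfl⟩ := g.exists_smoothField hi hs η
  have h := g.isLeviCivita_connection hi hs h𝒳
  have h1 := hΓ.nabla_eq _ h X Y hX hY x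
  have h2 := (g.isChristoffel_christoffel hi hs h𝒳).nabla_eq _ h X Y hX hY x
  exact add_left_cancel (h1.symm.trans h2)

/-- Changing a Christoffel function by a term that vanishes on tangent vectors. -/
theorem isChristoffel_add_normal {Γ : M → E →L[ℝ] E →L[ℝ] E} (hΓ : IsChristoffel g Γ)
    (Φ : E →L[ℝ] E →L[ℝ] E) :
    IsChristoffel g (fun x => Γ x + Φ ∘L (ContinuousLinearMap.id ℝ E - g.proj x)) where
  smooth := hΓ.smooth.add
    (contMDiff_const.clm_comp (contMDiff_const.sub (g.contMDiff_proj hi hs)))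
  nabla_eq cov hcov X Y hX hY x := by
    rw [hΓ.nabla_eq cov hcov X Y hX hY x]
    simp

theorem exists_ne_christoffel [Nonempty M] (hm : m < Module.finrank ℝ E)
    {Γ : M → E →L[ℝ] E →L[ℝ] E} (hΓ : IsChristoffel g Γ) :
    ∃ Γ' : M → E →L[ℝ] E →L[ℝ] E, IsChristoffel g Γ' ∧ Γ ≠ Γ' := by
  obtain ⟨x⟩ := ‹Nonempty M›
  have hlt : Module.finrank ℝ (ambientTangent m ι x) < Module.finrank ℝ E := by
    have h (T : EuclideanSpace ℝ (Fin m) →ₗ[ℝ] E) :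
        Module.finrank ℝ (LinearMap.range T) < Module.finrank ℝ E :=
      (LinearMap.finrank_range_le T).trans_lt (by rwa [finrank_euclideanSpace_fin])
    exact h (mvfderiv (𝓡 m) ι x).toLinearMap
  obtain ⟨v, hv⟩ : ∃ v, v ∉ ambientTangent m ι x := by
    by_contra! h
    rw [(Submodule.eq_top_iff').2 h, finrank_top] at hlt
    exact lt_irrefl _ hlt
  have hn : v - g.proj x v ≠ 0 := fun h => hv ((sub_eq_zero.1 h) ▸ g.proj_mem x v)
  -- With `n = v - Π v`, the added term `(a, b) ↦ ⟨a - Π a, b⟩ n` takes the nonzero value `⟨n, n⟩ n`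
  -- at `(v, n)`.
  refine ⟨_, g.isChristoffel_add_normal hi hs hΓ
    (innerSMul (v - g.proj x v)), fun h => hn ?_⟩
  have h1 := congrArg (fun Γ : M → E →L[ℝ] E →L[ℝ] E => Γ x v (v - g.proj x v)) h
  have h2 : inner ℝ (v - g.proj x v) (v - g.proj x v) • (v - g.proj x v) = 0 :=
    left_eq_add.1 h1
  exact (smul_eq_zero.1 h2).elim _root_.inner_self_eq_zero.1 id

omit hi hs [FiniteDimensional ℝ E] in
theorem exists_innerCore (x : M) : ∃ c : InnerProductSpace.Core ℝ E,
    ∀ v w : E, c.inner v w = inner ℝ v (g.op x w) :=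
  ⟨{ inner := fun v w => inner ℝ v (g.op x w)
     conj_inner_symm := fun v w => by
       rw [← g.symm x w v, real_inner_comm]
       rfl
     re_inner_nonneg := fun v => by
       by_cases hv : v = 0
       · simp [hv]
       · exact (g.pos x v hv).le
     add_left := fun _ _ _ => inner_add_left _ _ _
     smul_left := fun _ _ _ => inner_smul_left _ _ _
     definite := fun _ h => g.inner_self_eq_zero x h }, fun _ _ => rfl⟩

end MetricOperator

theorem RiemMetric.ext_inner {R R' : RiemMetric m M}
    (h : ∀ (x : M) (ξ η : TangentSpace (𝓡 m) x), R.inner x ξ η = R'.inner x ξ η) : R = R' := by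
  have : R.inner = R'.inner := funext fun x => by ext ξ η; exact h x ξ η
  cases R; cases R'; cases this; rfl

end Ambient

end AmbientGeometry

end

/-! ### The theorem. -/

theorem mainTheorem3 {m : ℕ} {M : Type*} [TopologicalSpace M]
    [ChartedSpace (EuclideanSpace ℝ (Fin m)) M] [IsManifold (𝓡 m) ∞ M]
    {E : Type*} [NormedAddCommGroup E] [InnerProductSpace ℝ E] [FiniteDimensional ℝ E]
    (ι : M → E) (hι : Manifold.IsSmoothEmbedding (𝓡 m) 𝓘(ℝ, E) ∞ ι)
    (R : AmbientGeometry.RiemMetric m M) (g : AmbientGeometry.MetricOperator R ι) :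
    -- `⟨v, g_x w⟩` is an inner product on `E`
    (∀ x : M, ∃ c : InnerProductSpace.Core ℝ E,
      ∀ v w : E, c.inner v w = inner ℝ v (g.op x w)) ∧
    -- the projection onto the tangent spaces is smooth
    ContMDiff (𝓡 m) 𝓘(ℝ, E →L[ℝ] E) ∞ g.proj ∧
    -- the Levi-Civita connection and a Christoffel function exist
    (∃ cov : AmbientGeometry.Connection m M, AmbientGeometry.IsLeviCivita R cov) ∧
    (∃ Γ : M → E →L[ℝ] E →L[ℝ] E, AmbientGeometry.IsChristoffel g Γ) ∧
    -- in positive codimension there is more than one Christoffel function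
    (Nonempty M → m < Module.finrank ℝ E →
      ∃ Γ₁ Γ₂ : M → E →L[ℝ] E →L[ℝ] E,
        AmbientGeometry.IsChristoffel g Γ₁ ∧ AmbientGeometry.IsChristoffel g Γ₂ ∧ Γ₁ ≠ Γ₂) ∧
    -- `(∇_X Y)_x - (D_X Y)_x` depends only on `X_x` and `Y_x`
    (∀ cov : AmbientGeometry.Connection m M, AmbientGeometry.IsLeviCivita R cov →
      ∀ X Y X' Y' : (x : M) → TangentSpace (𝓡 m) x,
        AmbientGeometry.IsSmoothField X → AmbientGeometry.IsSmoothField Y →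
        AmbientGeometry.IsSmoothField X' → AmbientGeometry.IsSmoothField Y' →
        ∀ x : M, X x = X' x → Y x = Y' x →
          AmbientGeometry.toAmbient ι (cov Y x (X x)) - AmbientGeometry.ambientDeriv ι X Y x =
            AmbientGeometry.toAmbient ι (cov Y' x (X' x)) -
              AmbientGeometry.ambientDeriv ι X' Y' x) ∧
    -- on tangent vectors, a Christoffel function depends only on the restriction of the metric
    -- operator to the tangent bundle
    (∀ (R' : AmbientGeometry.RiemMetric m M) (g' : AmbientGeometry.MetricOperator R' ι)
      (Γ Γ' : M → E →L[ℝ] E →L[ℝ] E),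
      AmbientGeometry.IsChristoffel g Γ → AmbientGeometry.IsChristoffel g' Γ' →
      (∀ (x : M) (ξ η : TangentSpace (𝓡 m) x),
        inner ℝ (AmbientGeometry.toAmbient ι ξ) (g.op x (AmbientGeometry.toAmbient ι η)) =
          inner ℝ (AmbientGeometry.toAmbient ι ξ) (g'.op x (AmbientGeometry.toAmbient ι η))) →
      ∀ (x : M) (ξ η : TangentSpace (𝓡 m) x),
        Γ x (AmbientGeometry.toAmbient ι ξ) (AmbientGeometry.toAmbient ι η) =
          Γ' x (AmbientGeometry.toAmbient ι ξ) (AmbientGeometry.toAmbient ι η)) ∧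
    -- index-raised terms exist, and the formula holds for every Christoffel function and every
    -- index-raised term
    (∃ 𝒳 : M → E →L[ℝ] E →L[ℝ] E, AmbientGeometry.IsIndexRaised g 𝒳) ∧
    (∀ Γ 𝒳 : M → E →L[ℝ] E →L[ℝ] E,
      AmbientGeometry.IsChristoffel g Γ → AmbientGeometry.IsIndexRaised g 𝒳 →
      ∀ (x : M) (ξ η : TangentSpace (𝓡 m) x),
        Γ x (AmbientGeometry.toAmbient ι ξ) (AmbientGeometry.toAmbient ι η) =
          -(AmbientGeometry.dirDeriv g.proj ξ (AmbientGeometry.toAmbient ι η)) +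
            (1 / 2 : ℝ) • g.proj x (g.inv x
              (AmbientGeometry.dirDeriv g.op ξ (AmbientGeometry.toAmbient ι η) +
                AmbientGeometry.dirDeriv g.op η (AmbientGeometry.toAmbient ι ξ) -
                𝒳 x (AmbientGeometry.toAmbient ι ξ) (AmbientGeometry.toAmbient ι η)))) := by
  have hs : ContMDiff (𝓡 m) 𝓘(ℝ, E) ∞ ι := hι.contMDiff
  have hi : ∀ x, Function.Injective (mvfderiv (𝓡 m) ι x) := fun x =>
    AmbientGeometry.injective_mvfderiv_of_isImmersionAt (hι.isImmersion.isImmersionAt x)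
  have h𝒳 := g.isIndexRaised_indexRaised hi hs
  have hΓ := g.isChristoffel_christoffel hi hs h𝒳
  have hLC := g.isLeviCivita_connection hi hs h𝒳
  refine ⟨g.exists_innerCore, g.contMDiff_proj hi hs, ⟨_, hLC⟩, ⟨_, hΓ⟩,
    fun _ hm => ?_, fun cov hcov X Y X' Y' hX hY hX' hY' x hXx hYx => ?_,
    fun R' g' Γ Γ' hΓ₁ hΓ₂ h x ξ η => ?_, ⟨_, h𝒳⟩, fun Γ 𝒳 hΓ₁ h𝒳₁ x ξ η => ?_⟩
  · obtain ⟨Γ', hΓ', hne⟩ := g.exists_ne_christoffel hi hs hm hΓ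
    exact ⟨_, Γ', hΓ, hΓ', hne⟩
  · rw [hΓ.nabla_eq cov hcov X Y hX hY, hΓ.nabla_eq cov hcov X' Y' hX' hY', hXx, hYx,
      add_sub_cancel_left, add_sub_cancel_left]
  -- Equal restrictions to tangent vectors mean equal Riemannian metrics, so one Levi-Civita
  -- connection determines both Christoffel functions.
  · obtain rfl : R = R' := AmbientGeometry.RiemMetric.ext_inner fun x ξ η => by
      rw [g.induces, g'.induces, h]
    obtain ⟨X, hX, rfl⟩ := g.exists_smoothField hi hs ξ
    obtain ⟨Y, hY, rfl⟩ := g.exists_smoothField hi hs η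
    exact add_left_cancel ((hΓ₁.nabla_eq _ hLC X Y hX hY x).symm.trans
      (hΓ₂.nabla_eq _ hLC X Y hX hY x))
  · rw [g.christoffel_eq hi hs hΓ₁ h𝒳₁, g.christoffel_apply, g.koszulTerm_apply,
      g.derivOp_toAmbient hi, g.derivOp_toAmbient hi, g.derivProj_toAmbient hi, map_smul]
    abel
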